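/- Let $G=(V,E)$ be a finite simple graph with $n$ vertices, and let $\mathcal F$ be a family of subsets of $V$, the valid distributions of faults, each of size at most $f$. A vertex cut is a set $C\subseteq V$ such that $G\setminus C$ is disconnected (two vertices outside $C$ are not joined by a path in $G\setminus C$); it is minimal if no proper subset of it is a vertex cut. Say that $\mathcal F$ has the weak cut property if for any two sets $A,B\subseteq V$ such that $A\cup B$ is a minimal vertex cut, either no $F\in\mathcal F$ contains $A$ or no $F\in\mathcal F$ contains $B$. If $\mathcal F$ has the weak cut property and $3f<n$, then Byzantine agreement is possible on $G$. That is, for every set of values there is a deterministic synchronous message-passing protocol on $G$ (it may depend on $G$ and $\mathcal F$; in each round every vertex may send a message to each of its neighbours, and a receiver knows from which neighbour a message came) that ends after a fixed finite number of rounds with every vertex outputting a value, such that for every $F\in\mathcal F$, every choice of starting values, and every behaviour of the vertices in $F$ (they may send arbitrary messages, different ones to different neighbours), the vertices outside $F$ all output the same value, and if the vertices outside $F$ all have the same starting value $a$, they output $a$. -/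

import Mathlib

universe u v

namespace Byzantine

/-- `C` is a vertex cut of `G`: the graph obtained by deleting the vertices of `C` is
disconnected, i.e. two of the remaining vertices are not joined by a path. -/
def IsVertexCut {V : Type u} (G : SimpleGraph V) (C : Set V) : Prop :=
  ¬ (G.induce Cᶜ).Preconnected

/-- A vertex cut none of whose proper subsets is a vertex cut. -/
def IsMinimalVertexCut {V : Type u} (G : SimpleGraph V) (C : Set V) : Prop :=
  Minimal (IsVertexCut G) C

/-- `valid` is the family of all valid distributions of faults, each given as the set of its
faulty vertices. The vertices of `A` can all simultaneously be faulty. -/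
def CanBeFaulty {V : Type u} (valid : Set (Set V)) (A : Set V) : Prop :=
  ∃ F ∈ valid, A ⊆ F

/-- The weak cut property, for every minimal vertex cut of `G`. -/
def WeakCutProperty {V : Type u} (G : SimpleGraph V) (valid : Set (Set V)) : Prop :=
  ∀ A B : Set V, IsMinimalVertexCut G (A ∪ B) →
    ¬ CanBeFaulty valid A ∨ ¬ CanBeFaulty valid B

/-- A deterministic synchronous message-passing protocol on `G` with starting values in `Val`.
Every vertex `x` has its own program, which may depend on `x` (so vertices have identifiers), on
`G` and on the family of valid distributions of faults, but not on the actual set of faulty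
vertices. In each round a vertex sends to each of its neighbours at most one message (`none`: no
message), and updates its state from the messages received, knowing from which neighbour each one
came. After `rounds` rounds it outputs a value. -/
structure Protocol {V : Type u} (G : SimpleGraph V) (Val : Type v) where
  /-- local states -/
  State : Type (max u v)
  /-- messages -/
  Msg : Type (max u v)
  /-- the initial state of a vertex with a given starting value -/
  init : V → Val → State
  /-- the messages that a vertex in a given state sends to its neighbours -/
  send : (x : V) → State → G.neighborSet x → Option Msg
  /-- the new state, from the old one and the messages received from the neighbours -/
  step : (x : V) → State → (G.neighborSet x → Option Msg) → State
  /-- the number of rounds -/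
  rounds : ℕ
  /-- the value decided on, from the state after the last round -/
  output : V → State → Val

/-- `state t x` is the state of `x` after `t` rounds and `msg t x y` is what `x` sends to `y` in
round `t`, in an execution of `P` with starting values `input` in which exactly the vertices of
`F` are faulty. The vertices outside `F` follow the protocol. Those in `F` are Byzantine: nothing
at all is required of what they send, which may differ from one neighbour to another. -/
structure IsExecution {V : Type u} {G : SimpleGraph V} {Val : Type v} (P : Protocol G Val)
    (F : Set V) (input : V → Val) (state : ℕ → V → P.State)
    (msg : ℕ → V → V → Option P.Msg) : Prop where
  init_eq : ∀ x, x ∉ F → state 0 x = P.init x (input x)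
  msg_eq : ∀ t x, x ∉ F → ∀ y : G.neighborSet x, msg t x y = P.send x (state t x) y
  step_eq : ∀ t x, x ∉ F →
    state (t + 1) x = P.step x (state t x) (fun y : G.neighborSet x => msg t y x)

/-- `P` solves Byzantine agreement if in every execution whose set of faulty vertices is a valid
distribution of faults, the non-faulty vertices all decide on the same value, and this is the
common starting value of the non-faulty vertices if they have one. (Every vertex decides after
the fixed number of rounds of `P`, hence termination.) -/
structure Protocol.SolvesAgreement {V : Type u} {G : SimpleGraph V} {Val : Type v}
    (P : Protocol G Val) (valid : Set (Set V)) : Prop where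
  agreement : ∀ F ∈ valid, ∀ input state msg, IsExecution P F input state msg →
    ∀ x y, x ∉ F → y ∉ F →
      P.output x (state P.rounds x) = P.output y (state P.rounds y)
  validity : ∀ F ∈ valid, ∀ input state msg, IsExecution P F input state msg →
    ∀ a : Val, (∀ x, x ∉ F → input x = a) →
      ∀ x, x ∉ F → P.output x (state P.rounds x) = a

/-- Byzantine agreement on values in `Val` is possible on `G`. -/
def AgreementPossible {V : Type u} (G : SimpleGraph V) (valid : Set (Set V))
    (Val : Type v) : Prop :=
  ∃ P : Protocol G Val, P.SolvesAgreement valid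

end Byzantine

namespace Byzantine

/-! The network is made to simulate a complete graph, on which exponential information gathering
works for `3 * f < n`. Deleting two valid fault sets leaves `G` connected. Let every vertex flood
its state for `n` rounds, and let a receiver believe what all routes avoiding some valid set report.
The actual fault set makes the true report a candidate; any other candidate shares a route with it
that avoids both sets, so it agrees (`IsExecution.decode_succ`). With `f + 1` such phases, nodes of
the gathering tree headed by a non-faulty vertex resolve to what that vertex held
(`resolve_cons_eq`), and every branch reaches one, since `f + 1` distinct vertices are not all
faulty (`resolve_eq_resolve`). -/

section Connectivity

variable {V : Type u} {G : SimpleGraph V}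

/-- If the weak cut property holds, two valid fault sets never cover a vertex cut. -/
theorem WeakCutProperty.preconnected_induce [Finite V] {valid : Set (Set V)}
    (hcut : WeakCutProperty G valid) {F₁ F₂ : Set V} (h₁ : F₁ ∈ valid) (h₂ : F₂ ∈ valid) :
    (G.induce (F₁ ∪ F₂)ᶜ).Preconnected := by
  by_contra h
  obtain ⟨C, hC, hmin⟩ := exists_minimal_le_of_wellFoundedLT (IsVertexCut G) (F₁ ∪ F₂) h
  have hsplit : C ∩ F₁ ∪ C ∩ F₂ = C := by
    rw [← Set.inter_union_distrib_left]
    exact Set.inter_eq_left.2 hC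
  rcases hcut (C ∩ F₁) (C ∩ F₂) (by rw [hsplit]; exact hmin) with h | h
  · exact h ⟨F₁, h₁, Set.inter_subset_right⟩
  · exact h ⟨F₂, h₂, Set.inter_subset_right⟩

/-- `Route G F x p y`: the list `p` is a lazy walk of `G` from `x` (not listed) to `y`, whose
listed vertices avoid `F`. -/
def Route (G : SimpleGraph V) (F : Set V) : V → List V → V → Prop
  | x, [], y => x = y
  | x, z :: p, y => z ∉ F ∧ (x = z ∨ G.Adj x z) ∧ Route G F z p y

theorem Route.mono {F F' : Set V} (h : F' ⊆ F) :
    ∀ {p : List V} {x y : V}, Route G F x p y → Route G F' x p y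
  | [], _, _, hp => hp
  | _ :: _, _, _, hp => ⟨fun hz => hp.1 (h hz), hp.2.1, Route.mono h hp.2.2⟩

theorem Route.exists_of_walk {F : Set V} {x y : (Fᶜ : Set V)} (w : (G.induce Fᶜ).Walk x y) :
    ∃ p : List V, p.length = w.length ∧ Route G F x p y := by
  induction w with
  | nil => exact ⟨[], rfl, rfl⟩
  | @cons a b c h w ih =>
    obtain ⟨p, hl, hp⟩ := ih
    exact ⟨b :: p, by simp [hl], b.2, Or.inr h, hp⟩

theorem Route.exists_length_add {F : Set V} {x y : V} (hx : x ∉ F) {p : List V}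
    (hp : Route G F x p y) : ∀ k : ℕ, ∃ q : List V, q.length = p.length + k ∧ Route G F x q y
  | 0 => ⟨p, rfl, hp⟩
  | k + 1 => by
    obtain ⟨q, hl, hq⟩ := Route.exists_length_add hx hp k
    exact ⟨x :: q, by simp [hl, add_assoc], hx, Or.inl rfl, hq⟩

/-- A path has fewer than `n` edges, and lazy steps at `x` pad it. With one common length, all
reports read by `decode` date from the same round. -/
theorem Route.exists_length_eq_card [Fintype V] {F : Set V}
    (hF : (G.induce Fᶜ).Preconnected) {x y : V} (hx : x ∉ F) (hy : y ∉ F) :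
    ∃ p : List V, p.length = Fintype.card V ∧ Route G F x p y := by
  classical
  obtain ⟨w, hw⟩ := (hF ⟨x, hx⟩ ⟨y, hy⟩).exists_isPath
  obtain ⟨p, hl, hp⟩ := Route.exists_of_walk w
  have hlt : w.length < Fintype.card V :=
    hw.length_lt.trans_le (Fintype.card_subtype_le _)
  obtain ⟨q, hlq, hq⟩ := Route.exists_length_add hx hp (Fintype.card V - p.length)
  exact ⟨q, by omega, hq⟩

end Connectivity

section Relay

variable {V : Type u} {Val : Type v}

open Classical in
/-- The state after one more round of flooding: the entry at `y :: l` is the entry at `l` reported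
by `y`, if `y` is a neighbour of `x`, and the own old entry otherwise. -/
noncomputable def relayStep (G : SimpleGraph V) (x : V) (s : List V → Val)
    (m : G.neighborSet x → Option (List V → Val)) : List V → Val
  | [] => s []
  | y :: l => if h : G.Adj x y then (m ⟨y, h⟩).getD s l else s l

/-- In each round every vertex sends its whole state to all its neighbours. -/
noncomputable def relayProtocol (G : SimpleGraph V) (Val : Type v) (rounds : ℕ)
    (output : V → (List V → Val) → Val) : Protocol G Val where
  State := List V → Val
  Msg := List V → Val
  init _ a := fun _ => a
  send _ s _ := some s
  step := relayStep G
  rounds := rounds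
  output := output

variable {G : SimpleGraph V} {rounds : ℕ} {output : V → (List V → Val) → Val} {F : Set V}
  {input : V → Val} {state : ℕ → V → List V → Val} {msg : ℕ → V → V → Option (List V → Val)}

theorem IsExecution.relay_succ_cons
    (h : IsExecution (relayProtocol G Val rounds output) F input state msg) {x y : V}
    (hx : x ∉ F) (hy : y ∉ F) (hxy : x = y ∨ G.Adj x y) (t : ℕ) (l : List V) :
    state (t + 1) x (y :: l) = state t y l := by
  have hs : state (t + 1) x =
      relayStep G x (state t x) (fun z : G.neighborSet x => msg t z x) := h.step_eq t x hx
  rw [hs]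
  rcases hxy with rfl | hadj
  -- No vertex is its own neighbour, so `relayStep` reads the own old entry: a lazy step.
  · simp [relayStep]
  · have hm : msg t y x = some (state t y) := h.msg_eq t y hy ⟨x, hadj.symm⟩
    simp [relayStep, hadj, hm]

theorem IsExecution.relay_route
    (h : IsExecution (relayProtocol G Val rounds output) F input state msg) (t : ℕ) (l : List V) :
    ∀ {p : List V} {x y : V}, x ∉ F → Route G F x p y →
      state (t + p.length) x (p ++ l) = state t y l
  | [], x, y, _, hp => by
    have hxy : x = y := hp
    simp [hxy]
  | z :: p, x, y, hx, hp => by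
    rw [List.length_cons, ← add_assoc, List.cons_append,
      h.relay_succ_cons hx hp.1 hp.2.1, h.relay_route t l hp.1 hp.2.2]

end Relay

section Transmission

variable {V : Type u} {Val : Type v} [Nonempty Val]

/-- Reliable transmission along routes of length `N`: what `x`, with state `s`, believes that the
first vertex of the list believes that the second one believes …; a report is believed if it is
the one received along all routes that avoid some valid fault set. -/
noncomputable def decode (G : SimpleGraph V) (valid : Set (Set V)) (N : ℕ) :
    V → (List V → Val) → List V → Val
  | _, s, [] => s []
  | x, s, y :: L => Classical.epsilon fun v => ∃ F ∈ valid, x ∉ F ∧ y ∉ F ∧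
      ∀ p : List V, p.length = N → Route G F x p y →
        decode G valid N y (fun l => s (p ++ l)) L = v

theorem IsExecution.decode_succ [Fintype V] {G : SimpleGraph V} {valid : Set (Set V)}
    {rounds : ℕ} {output : V → (List V → Val) → Val} {F : Set V} {input : V → Val}
    {state : ℕ → V → List V → Val} {msg : ℕ → V → V → Option (List V → Val)}
    (h : IsExecution (relayProtocol G Val rounds output) F input state msg)
    (hcut : WeakCutProperty G valid) (hF : F ∈ valid) {x y : V} (hx : x ∉ F) (hy : y ∉ F)
    (k : ℕ) (L : List V) :
    decode G valid (Fintype.card V) x (state (Fintype.card V * (k + 1)) x) (y :: L) =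
      decode G valid (Fintype.card V) y (state (Fintype.card V * k) y) L := by
  have hroute : ∀ p : List V, p.length = Fintype.card V → Route G F x p y →
      decode G valid (Fintype.card V) y
        (fun l => state (Fintype.card V * (k + 1)) x (p ++ l)) L =
      decode G valid (Fintype.card V) y (state (Fintype.card V * k) y) L := by
    intro p hl hp
    congr 1
    funext l
    rw [← h.relay_route (Fintype.card V * k) l hx hp, hl, Nat.mul_succ]
  rw [decode]
  obtain ⟨F', hF', hx', hy', hv⟩ := Classical.epsilon_spec
    (p := fun v => ∃ F ∈ valid, x ∉ F ∧ y ∉ F ∧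
      ∀ p : List V, p.length = Fintype.card V → Route G F x p y →
        decode G valid (Fintype.card V) y
          (fun l => state (Fintype.card V * (k + 1)) x (p ++ l)) L = v)
    ⟨_, F, hF, hx, hy, hroute⟩
  -- The believed value comes with some valid `F'`, perhaps not `F`; a route avoiding both forces it
  -- to be the true one.
  obtain ⟨p, hl, hp⟩ := Route.exists_length_eq_card (hcut.preconnected_induce hF hF')
    (x := x) (y := y) (by simp [hx, hx']) (by simp [hy, hy'])
  rw [← hv p hl (hp.mono Set.subset_union_right),
    hroute p hl (hp.mono Set.subset_union_left)]

end Transmission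

section Resolve

variable {V : Type u} {Val : Type v} [Nonempty Val]

/-- Exponential information gathering: the value attached to the node `M` of the tree, from those
attached by `c` to its descendants `d` levels below. A value is attached to a node if its children
with at most `f` exceptions have it. -/
noncomputable def resolve (f : ℕ) (c : List V → Val) : ℕ → List V → Val
  | 0, M => c M
  | d + 1, M => Classical.epsilon fun v => ∃ F : Set V, F.ncard ≤ f ∧
      ∀ q, q ∉ F → q ∉ M → resolve f c d (q :: M) = v

theorem exists_notMem_of_three_mul_lt [Fintype V] {f : ℕ} (hn : 3 * f < Fintype.card V)
    {F F' : Set V} (hF : F.ncard ≤ f) (hF' : F'.ncard ≤ f) {M : List V} (hM : M.length ≤ f) :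
    ∃ q, q ∉ F ∧ q ∉ F' ∧ q ∉ M := by
  classical
  by_contra! h
  have huniv : (Set.univ : Set V) ⊆ F ∪ F' ∪ (M.toFinset : Set V) := by
    intro q _
    by_cases h₁ : q ∈ F
    · exact Or.inl (Or.inl h₁)
    by_cases h₂ : q ∈ F'
    · exact Or.inl (Or.inr h₂)
    exact Or.inr (by simpa using h q h₁ h₂)
  have hle := Set.ncard_le_ncard huniv (Set.toFinite _)
  rw [Set.ncard_univ, Nat.card_eq_fintype_card] at hle
  have hu := Set.ncard_union_le (F ∪ F') (M.toFinset : Set V)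
  have hu' := Set.ncard_union_le F F'
  rw [Set.ncard_coe_finset] at hu
  have hM' := M.toFinset_card_le
  omega

/-- Two exception sets and `M` cover at most `3 * f` vertices, so two candidate values share a
child. -/
theorem resolve_succ_eq [Fintype V] {f : ℕ} (hn : 3 * f < Fintype.card V) {c : List V → Val}
    {F : Set V} (hF : F.ncard ≤ f) {d : ℕ} {M : List V} (hM : M.length ≤ f) {a : Val}
    (h : ∀ q, q ∉ F → q ∉ M → resolve f c d (q :: M) = a) :
    resolve f c (d + 1) M = a := by
  rw [resolve]
  obtain ⟨F', hF', hv⟩ := Classical.epsilon_spec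
    (p := fun v => ∃ F : Set V, F.ncard ≤ f ∧
      ∀ q, q ∉ F → q ∉ M → resolve f c d (q :: M) = v) ⟨a, F, hF, h⟩
  obtain ⟨q, hq, hq', hqM⟩ := exists_notMem_of_three_mul_lt hn hF hF' hM
  rw [← hv q hq' hqM, h q hq hqM]

/-- Equal predicates have equal `epsilon`, so this holds even if no value qualifies. -/
theorem resolve_succ_congr {f : ℕ} {c c' : List V → Val} {d : ℕ} {M : List V}
    (h : ∀ q, q ∉ M → resolve f c d (q :: M) = resolve f c' d (q :: M)) :
    resolve f c (d + 1) M = resolve f c' (d + 1) M := by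
  rw [resolve, resolve]
  congr 1
  funext v
  refine propext (exists_congr fun F => and_congr_right fun _ => forall_congr' fun q =>
    forall_congr' fun _ => forall_congr' fun hq => ?_)
  rw [h q hq]

variable {f : ℕ} {F : Set V} {B : ℕ → V → List V → Val}

/-- A non-faulty `y` reports the same to all non-faulty vertices, so by induction all non-faulty
children of `y :: M` carry this value. Here `B k x` is what `x` believes after `k` phases. -/
theorem resolve_cons_eq [Fintype V] (hn : 3 * f < Fintype.card V) (hF : F.ncard ≤ f)
    (hB : ∀ k x y L, x ∉ F → y ∉ F → B (k + 1) x (y :: L) = B k y L) {x : V} (hx : x ∉ F) :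
    ∀ (d : ℕ) (y : V) (M : List V), y ∉ F → M.length + d = f →
      resolve f (B (f + 1) x) d (y :: M) = B M.length y M
  | 0, y, M, hy, hM => by
    rw [resolve, hB f x y M hx hy, ← hM, add_zero]
  | d + 1, y, M, hy, hM => by
    refine resolve_succ_eq hn hF (by rw [List.length_cons]; omega) fun q hq _ => ?_
    rw [resolve_cons_eq hn hF hB hx d q (y :: M) hq (by rw [List.length_cons]; omega),
      List.length_cons, hB _ q y M hq hy]

theorem resolve_eq_resolve [Fintype V] (hn : 3 * f < Fintype.card V) (hF : F.ncard ≤ f)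
    (hB : ∀ k x y L, x ∉ F → y ∉ F → B (k + 1) x (y :: L) = B k y L) {x x' : V}
    (hx : x ∉ F) (hx' : x' ∉ F) :
    ∀ (d : ℕ) (M : List V), M.Nodup → (∀ z ∈ M, z ∈ F) → M.length + d = f + 1 →
      resolve f (B (f + 1) x) d M = resolve f (B (f + 1) x') d M
  | 0, M, hnd, hMF, hM => by
    classical
    have hsub : (M.toFinset : Set V) ⊆ F := fun z hz => hMF z (by simpa using hz)
    have hle := Set.ncard_le_ncard hsub (Set.toFinite _)
    rw [Set.ncard_coe_finset, List.toFinset_card_of_nodup hnd] at hle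
    -- `M` would consist of `f + 1` distinct faulty vertices.
    omega
  | d + 1, M, hnd, hMF, hM => by
    refine resolve_succ_congr fun q hqM => ?_
    by_cases hq : q ∈ F
    · refine resolve_eq_resolve hn hF hB hx hx' d (q :: M) (List.nodup_cons.2 ⟨hqM, hnd⟩) ?_
        (by rw [List.length_cons]; omega)
      rintro z hz
      rcases List.mem_cons.1 hz with rfl | hz
      · exact hq
      · exact hMF z hz
    · rw [resolve_cons_eq hn hF hB hx d q M hq (by omega),
        resolve_cons_eq hn hF hB hx' d q M hq (by omega)]

end Resolve

theorem WeakCutProperty.agreementPossible {V : Type u} [Fintype V] {G : SimpleGraph V}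
    {valid : Set (Set V)} {f : ℕ} (hf : ∀ F ∈ valid, F.ncard ≤ f) (hn : 3 * f < Fintype.card V)
    (hcut : WeakCutProperty G valid) (Val : Type v) :
    AgreementPossible G valid Val := by
  rcases isEmpty_or_nonempty Val with hVal | hVal
  · exact ⟨relayProtocol G Val 0 fun _ s => s [],
      ⟨fun _ _ _ _ _ _ _ _ _ _ => Subsingleton.elim _ _,
        fun _ _ _ _ _ _ _ _ _ _ => Subsingleton.elim _ _⟩⟩
  have hB {F input state msg} (hF : F ∈ valid)
      (h : IsExecution (relayProtocol G Val (Fintype.card V * (f + 1)) fun x s =>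
        resolve f (decode G valid (Fintype.card V) x s) (f + 1) []) F input state msg) :
      ∀ k x y L, x ∉ F → y ∉ F →
        decode G valid (Fintype.card V) x (state (Fintype.card V * (k + 1)) x) (y :: L) =
          decode G valid (Fintype.card V) y (state (Fintype.card V * k) y) L :=
    fun k _ _ L hx hy => h.decode_succ hcut hF hx hy k L
  refine ⟨relayProtocol G Val (Fintype.card V * (f + 1)) fun x s =>
    resolve f (decode G valid (Fintype.card V) x s) (f + 1) [], ⟨?_, ?_⟩⟩
  · intro F hF input state msg h x y hx hy
    exact resolve_eq_resolve
      (B := fun k x => decode G valid (Fintype.card V) x (state (Fintype.card V * k) x))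
      hn (hf F hF) (hB hF h) hx hy (f + 1) [] List.nodup_nil (by simp) (by simp)
  · intro F hF input state msg h a ha x hx
    refine resolve_succ_eq hn (hf F hF) (M := []) (Nat.zero_le f)
      fun q hq _ => ?_
    refine (resolve_cons_eq
      (B := fun k x => decode G valid (Fintype.card V) x (state (Fintype.card V * k) x))
      hn (hf F hF) (hB hF h) hx f q [] hq (by simp)).trans ?_
    have h₀ : state 0 q = fun _ => input q := h.init_eq q hq
    simp [decode, h₀, ha q hq]

end Byzantine

theorem theorem5 {V : Type u} [Fintype V] (G : SimpleGraph V) (valid : Set (Set V)) (f : ℕ)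
    (hf : ∀ F ∈ valid, F.ncard ≤ f) (hn : 3 * f < Fintype.card V)
    (hcut : Byzantine.WeakCutProperty G valid) (Val : Type v) :
    Byzantine.AgreementPossible G valid Val :=
  hcut.agreementPossible hf hn Val
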